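/- For $n \ge 1$ let $\mathcal{T}$ be a tree chosen uniformly at random from all labelled trees on the vertex set $[n]=\{1,\dots,n\}$. For $K \in \mathbb{N}$, call a vertex $v$ of $\mathcal{T}$ \emph{internal} if there is no edge $e$ of $\mathcal{T}$ incident to $v$ such that the component containing $v$ of the forest obtained from $\mathcal{T}$ by removing $e$ (rooted at $v$ and relabelled in an order-preserving way) is a rooted labelled tree on at most $K$ vertices. Let $R=R_K(\mathcal{T})$ be the set of internal vertices, and let $$h(K) := 1 - \sum_{k=1}^{K} \frac{(k/e)^k}{k\cdot k!}.$$ Then for every fixed $K \in \mathbb{N}$, asymptotically almost surely $|R|/n \sim h(K)$ as $n \to \infty$; that is, for every $\varepsilon > 0$, $$\lim_{n\to\infty} \mathbb{P}\left( \left| \frac{|R|}{n\, h(K)} - 1 \right| \le \varepsilon \right) = 1.$$ Moreover, $h(K) = \Theta(1/\sqrt{K})$ as $K \to \infty$. -/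

import Mathlib

namespace RandomTree

/-- The vertex set of the component containing `v` after the edge `vw` is removed from `G`. -/
def branch {n : ℕ} (G : SimpleGraph (Fin n)) (v w : Fin n) : Set (Fin n) :=
  {u | (G.deleteEdges {s(v, w)}).Reachable v u}

/-- The vertex `v` of `G` is of type `(T, r)`, where `T` is a graph on `k` labelled vertices and `r`
is one of them: for some edge `vw` of `G`, the component of `v` after removing `vw`, rooted at `v`
and relabelled with the labels of `Fin k` so that the relative order is preserved, is `(T, r)`. -/
def IsOfType {n : ℕ} (G : SimpleGraph (Fin n)) (v : Fin n)
    {k : ℕ} (T : SimpleGraph (Fin k)) (r : Fin k) : Prop :=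
  ∃ w, G.Adj v w ∧ ∃ e : Fin k ≃o branch G v w,
    (e r : Fin n) = v ∧
      ∀ i j, T.Adj i j ↔ (G.deleteEdges {s(v, w)}).Adj (e i) (e j)

/-- The internal vertices of `G`: those that are not of type `(T, r)` for any rooted labelled
tree `(T, r)` on at most `K` vertices. -/
def internalVertices (K : ℕ) {n : ℕ} (G : SimpleGraph (Fin n)) : Set (Fin n) :=
  {v | ¬ ∃ k : ℕ, k ≤ K ∧ ∃ (T : SimpleGraph (Fin k)) (r : Fin k), T.IsTree ∧ IsOfType G v T r}

/-- The law of a uniformly random labelled tree on `n` vertices. -/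
noncomputable def law (n : ℕ) : MeasureTheory.Measure (SimpleGraph (Fin n)) :=
  ProbabilityTheory.uniformOn {G | G.IsTree}

/-- The limiting proportion `1 - ∑_{k=1}^K (k/e)^k / (k * k!)`. -/
noncomputable def h (K : ℕ) : ℝ :=
  1 - ∑ k ∈ Finset.Icc 1 K, ((k : ℝ) / Real.exp 1) ^ k / ((k : ℝ) * (k.factorial : ℝ))

end RandomTree

namespace RandomTree

open Finset

/-! ### An Abel-type identity -/

/-! A vertex of a tree fails to be internal exactly when some edge cuts off, on its side, a branch
with at most `K` vertices; the shape of the branch is irrelevant, since all shapes are allowed. When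
`2 * K < n`, two small branches are nested or disjoint, so each vertex is the root of at most one of
them. Hence `|R| = n - X`, where `X` is the number of small cuts (`ncard_internalVertices`), and it
remains to show by a second moment argument that `X / n` concentrates at `1 - h K`.

Cutting an edge identifies trees with a prescribed cut with pairs of trees (`card_isTree_isCut`).
Writing `T k` for `treeCount k`, the mean number of cuts with part of size `k` is `C(n,k) k (n-k) T
k T (n-k) / T n`, which is asymptotic to `n * borel k`. For the second moment, disjoint pairs of
small cuts contribute at most asymptotically the square of the mean, and intersecting pairs number
at most `K (K+1) X`. So the variance of `X / n` tends to 0 and Chebyshev's inequality applies. The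
same double count over all cuts proves Cayley's formula by induction, with Abel's identity
evaluating the sum.

Abel's identity divided by `n! e^n` is also the renewal equation for `borel` and `renewal`
(`sum_borel_mul_renewal`). Its summed form `∑ renewal j * h (n - j) = 1` (`sum_renewal_mul_h`),
together with `renewal m ≥ 1 / (e √m)` from Stirling, gives both `h > 0` and `h n ≤ e / √n`. The
matching lower bound comes from summing `borel` over the sizes from `n + 1` to `2 n`. -/

/-- An alternating binomial sum that vanishes except in degree one. -/
theorem sum_choose_mul_neg_one_pow_mul_pow_div (m : ℕ) :
    ∑ k ∈ range (m + 1), (m.choose k : ℝ) * (-1) ^ (m - k) * (k : ℝ) ^ (m - k) *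
      ((k : ℝ) ^ k / k) = if m = 1 then 1 else 0 := by
  rcases m with _ | _ | m
  · simp
  · simp [sum_range_succ]
  -- For degree `m + 2` the sum is an iterated difference of order `m + 2` of the polynomial `r ^ (m
  -- + 1)`, of smaller degree. The term `k = 0` is 0 on both sides because `x / 0 = 0`.
  · have key : (fwdDiff (1 : ℝ))^[m + 2] (fun r : ℝ => r ^ (m + 1)) 0 = 0 := by
      rw [fwdDiff_iter_pow_eq_zero_of_lt (by omega)]; rfl
    rw [fwdDiff_iter_eq_sum_shift] at key
    rw [if_neg (by omega), ← key]
    refine sum_congr rfl fun k hk => ?_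
    have hk' : k ≤ m + 2 := by simpa [Nat.lt_succ_iff] using hk
    rcases Nat.eq_zero_or_pos k with rfl | hk0
    · simp
    · have hk1 : (k : ℝ) ≠ 0 := by positivity
      have : (k : ℝ) ^ (m + 2 - k) * ((k : ℝ) ^ k / k) = (k : ℝ) ^ (m + 1) := by
        rw [← mul_div_assoc, ← pow_add, Nat.sub_add_cancel hk', pow_succ, mul_div_cancel_right₀ _ hk1]
      rw [mul_assoc, this]
      simp only [zsmul_eq_mul, nsmul_eq_mul, mul_one, zero_add]
      push_cast
      ring

/-- Abel's identity `∑ C(n,k) k^(k-1) (n-k)^(n-k) = n^n`. -/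
theorem sum_choose_mul_pow_div_mul_pow {n : ℕ} (hn : 1 ≤ n) :
    ∑ k ∈ range (n + 1), (n.choose k : ℝ) * ((k : ℝ) ^ k / k) * ((n - k : ℕ) : ℝ) ^ (n - k) =
      (n : ℝ) ^ n := by
  -- Expand `(n - k) ^ (n - k)` as a power of `n + (-k)`; after exchanging the sums, the inner sum
  -- is the alternating sum of degree `n - j`.
  have h1 : ∀ k ∈ range (n + 1),
      (n.choose k : ℝ) * ((k : ℝ) ^ k / k) * ((n - k : ℕ) : ℝ) ^ (n - k) =
      ∑ j ∈ range (n - k + 1), (n.choose j : ℝ) * (n : ℝ) ^ j *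
        (((n - j).choose k : ℝ) * (-1) ^ (n - j - k) * (k : ℝ) ^ (n - j - k) *
          ((k : ℝ) ^ k / k)) := by
    intro k hk
    have hk' : k ≤ n := by simpa [Nat.lt_succ_iff] using hk
    rw [Nat.cast_sub hk', sub_eq_add_neg, add_pow, mul_sum]
    refine sum_congr rfl fun j hj => ?_
    have hj' : j + k ≤ n := by have := mem_range.1 hj; omega
    have hc : (n.choose k : ℝ) * ((n - k).choose j : ℝ) =
        (n.choose j : ℝ) * ((n - j).choose k : ℝ) := by
      have e1 := Nat.choose_mul (n := n) (k := k + j) (s := k) (by omega)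
      have e2 := Nat.choose_mul (n := n) (k := k + j) (s := j) (by omega)
      have e3 : (k + j).choose k = (k + j).choose j := Nat.choose_symm_add
      rw [Nat.add_sub_cancel_left] at e1
      rw [Nat.add_sub_cancel] at e2
      rw [e3, e2] at e1
      exact_mod_cast e1.symm
    rw [show n - k - j = n - j - k by omega, neg_pow]
    linear_combination ((k : ℝ) ^ k / k) * (n : ℝ) ^ j * (-1) ^ (n - j - k) *
      (k : ℝ) ^ (n - j - k) * hc
  rw [sum_congr rfl h1]
  have h2 : ∑ k ∈ range (n + 1), ∑ j ∈ range (n - k + 1), (n.choose j : ℝ) * (n : ℝ) ^ j *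
        (((n - j).choose k : ℝ) * (-1) ^ (n - j - k) * (k : ℝ) ^ (n - j - k) *
          ((k : ℝ) ^ k / k)) =
      ∑ j ∈ range (n + 1), ∑ k ∈ range (n - j + 1), (n.choose j : ℝ) * (n : ℝ) ^ j *
        (((n - j).choose k : ℝ) * (-1) ^ (n - j - k) * (k : ℝ) ^ (n - j - k) *
          ((k : ℝ) ^ k / k)) := by
    refine sum_comm' fun x y => ?_
    simp only [mem_range]
    omega
  rw [h2]
  simp_rw [← mul_sum, sum_choose_mul_neg_one_pow_mul_pow_div]
  -- Only degree `n - j = 1` survives, leaving `C(n, n-1) * n ^ (n - 1) = n ^ n`.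
  rw [sum_eq_single (n - 1)]
  · rw [if_pos (by omega), Nat.choose_symm hn, Nat.choose_one_right, mul_one, ← pow_succ',
      Nat.sub_add_cancel hn]
  · intro j hj hj'
    rw [if_neg (by have := mem_range.1 hj; omega), mul_zero]
  · intro hh; exact absurd (mem_range.2 (by omega)) hh

/-! ### The Borel distribution and its tail -/

/-- The probability `(k/e)^k / (k * k!)` that a Borel random variable is `k`. -/
noncomputable def borel (k : ℕ) : ℝ :=
  ((k : ℝ) / Real.exp 1) ^ k / ((k : ℝ) * (k.factorial : ℝ))

/-- The renewal density `(m/e)^m / m!` associated with `borel`. -/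
noncomputable def renewal (m : ℕ) : ℝ :=
  ((m : ℝ) / Real.exp 1) ^ m / (m.factorial : ℝ)

@[simp] theorem borel_zero : borel 0 = 0 := by simp [borel]

theorem borel_eq (k : ℕ) : borel k = renewal k / k := by
  rw [borel, renewal, div_div, mul_comm]

theorem renewal_pos (m : ℕ) : 0 < renewal m := by
  rcases Nat.eq_zero_or_pos m with rfl | hm
  · simp [renewal]
  · unfold renewal; positivity

theorem borel_nonneg (k : ℕ) : 0 ≤ borel k := by
  rw [borel_eq]; exact div_nonneg (renewal_pos k).le k.cast_nonneg

theorem renewal_le_one (m : ℕ) : renewal m ≤ 1 := by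
  have h := Real.pow_div_factorial_le_exp (m : ℝ) m.cast_nonneg m
  rw [renewal, div_pow, ← Real.exp_nat_mul, mul_one, div_right_comm]
  exact div_le_one_of_le₀ h (Real.exp_pos _).le

/-- The Stirling sequence decreases from its first value `e / √2`, which bounds `m!` from above. -/
theorem one_div_le_renewal {m : ℕ} (hm : 1 ≤ m) :
    1 / (Real.exp 1 * Real.sqrt m) ≤ renewal m := by
  have hs : Stirling.stirlingSeq m ≤ Real.exp 1 / Real.sqrt 2 := by
    have := Stirling.stirlingSeq'_antitone (Nat.zero_le (m - 1))
    simp only [Function.comp, Nat.succ_eq_add_one, Nat.sub_add_cancel hm, zero_add,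
      Stirling.stirlingSeq_one] at this
    exact this
  have hm0 : (0 : ℝ) < m := by exact_mod_cast hm
  rw [Stirling.stirlingSeq, Real.sqrt_mul (by norm_num), div_le_div_iff₀ (by positivity)
    (by positivity)] at hs
  rw [renewal, div_le_div_iff₀ (by positivity) (by positivity)]
  have h2 : (0 : ℝ) < Real.sqrt 2 := by positivity
  nlinarith

/-- Abel's identity divided by `n! e^n`. This is the renewal equation: decompose by the position of
the first renewal. -/
theorem sum_borel_mul_renewal {n : ℕ} (hn : 1 ≤ n) :
    ∑ k ∈ range (n + 1), borel k * renewal (n - k) = renewal n := by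
  have habel := sum_choose_mul_pow_div_mul_pow hn
  rw [renewal, div_pow, ← habel, sum_div, sum_div]
  refine sum_congr rfl fun k hk => ?_
  have hk' : k ≤ n := by simpa [Nat.lt_succ_iff] using hk
  rw [borel, renewal, Nat.cast_choose ℝ hk', div_pow, div_pow]
  have he : Real.exp 1 ^ n = Real.exp 1 ^ k * Real.exp 1 ^ (n - k) := by
    rw [← pow_add, Nat.add_sub_cancel' hk']
  have hf : (n.factorial : ℝ) ≠ 0 := by positivity
  rw [he]
  rcases Nat.eq_zero_or_pos k with rfl | hk0
  · simp
  · have hk1 : (k : ℝ) ≠ 0 := by positivity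
    field_simp

theorem h_eq (K : ℕ) : h K = 1 - ∑ k ∈ Icc 1 K, borel k := rfl

theorem h_zero : h 0 = 1 := by simp [h]

theorem h_succ (K : ℕ) : h (K + 1) = h K - borel (K + 1) := by
  rw [h_eq, h_eq, sum_Icc_succ_top (by omega)]; ring

theorem h_antitone : Antitone h :=
  antitone_nat_of_succ_le fun K => by rw [h_succ]; linarith [borel_nonneg (K + 1)]

theorem h_le_one (K : ℕ) : h K ≤ 1 := h_zero ▸ h_antitone (Nat.zero_le K)

/-- Summed form of the renewal equation: in a renewal process, decompose by the last renewal up to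
time `n`. The induction uses only `h_succ` and the renewal equation, so it does not presuppose that
`borel` has total mass at most 1. -/
theorem sum_renewal_mul_h (n : ℕ) : ∑ j ∈ range (n + 1), renewal j * h (n - j) = 1 := by
  induction n with
  | zero => simp [renewal, h_zero]
  | succ n ih =>
    have hren := sum_borel_mul_renewal (n := n + 1) (by omega)
    rw [← sum_range_reflect] at hren
    have e : ∀ j ∈ range (n + 1), renewal j * h (n + 1 - j) =
        renewal j * h (n - j) - borel (n + 1 - j) * renewal j := by
      intro j hj
      have : n + 1 - j = (n - j) + 1 := by have := mem_range.1 hj; omega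
      rw [this, h_succ]; ring
    rw [sum_range_succ] at hren ⊢
    rw [sum_congr rfl e, sum_sub_distrib, ih]
    have e2 : ∑ j ∈ range (n + 1), borel (n + 1 + 1 - 1 - j) *
        renewal (n + 1 - (n + 1 + 1 - 1 - j)) =
        ∑ j ∈ range (n + 1), borel (n + 1 - j) * renewal j := by
      refine sum_congr rfl fun j hj => ?_
      have := mem_range.1 hj
      congr 2
      omega
    rw [e2] at hren
    simp only [Nat.add_sub_cancel, Nat.sub_self, borel_zero, zero_mul, add_zero] at hren
    rw [hren, Nat.sub_self, h_zero]; ring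

theorem sqrt_div_exp_le_sum_renewal (n : ℕ) :
    Real.sqrt n / Real.exp 1 ≤ ∑ j ∈ range (n + 1), renewal j := by
  rw [sum_range_succ']
  have h1 : ∑ _j ∈ range n, 1 / (Real.exp 1 * Real.sqrt n) ≤ ∑ j ∈ range n, renewal (j + 1) := by
    refine sum_le_sum fun j hj => le_trans ?_ (one_div_le_renewal (by omega))
    have hj' : ((j + 1 : ℕ) : ℝ) ≤ n := by exact_mod_cast mem_range.1 hj
    have : 0 < Real.sqrt ((j + 1 : ℕ) : ℝ) := Real.sqrt_pos.2 (by positivity)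
    gcongr
  have h2 : ∑ _j ∈ range n, 1 / (Real.exp 1 * Real.sqrt n) = Real.sqrt n / Real.exp 1 := by
    rw [sum_const, card_range, nsmul_eq_mul, mul_one_div, mul_comm (Real.exp 1), ← div_div,
      Real.div_sqrt]
  have := renewal_pos 0
  linarith

/-- Otherwise `h` would stay below a negative constant from `K + 1` on. As the partial sums of
`renewal` are unbounded, this would drive the identity `sum_renewal_mul_h` below 1. -/
theorem h_pos (K : ℕ) : 0 < h K := by
  by_contra! hK
  have hlt : h (K + 1) < 0 := by
    have : 0 < borel (K + 1) := by
      rw [borel_eq]; exact div_pos (renewal_pos _) (by positivity)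
    rw [h_succ]; linarith
  set δ := -h (K + 1) with hδ
  have hδ0 : 0 < δ := by linarith
  -- Chosen so that the `m + 1` terms with `h ≤ -δ`, whose sum is at most `-δ √m / e`, outweigh the
  -- remaining `K + 1` terms, each at most 1.
  obtain ⟨m, hm⟩ := exists_nat_gt (((K + 1 : ℝ) * Real.exp 1 / δ) ^ 2)
  have hsq : (K + 1 : ℝ) < δ * (Real.sqrt m / Real.exp 1) := by
    have : (K + 1 : ℝ) * Real.exp 1 / δ < Real.sqrt m := Real.lt_sqrt_of_sq_lt hm
    rw [div_lt_iff₀ hδ0] at this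
    rw [← mul_div_assoc, lt_div_iff₀ (Real.exp_pos 1)]
    linarith
  have hsum := sum_renewal_mul_h (m + K + 1)
  rw [show m + K + 1 + 1 = (m + 1) + (K + 1) by ring, sum_range_add] at hsum
  have h1 : ∑ j ∈ range (m + 1), renewal j * h (m + K + 1 - j) ≤
      ∑ j ∈ range (m + 1), renewal j * (-δ) := by
    refine sum_le_sum fun j hj => mul_le_mul_of_nonneg_left ?_ (renewal_pos j).le
    rw [hδ, neg_neg]
    exact h_antitone (by have := mem_range.1 hj; omega)
  have h2 : ∑ j ∈ range (K + 1), renewal (m + 1 + j) * h (m + K + 1 - (m + 1 + j)) ≤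
      ∑ _j ∈ range (K + 1), (1 : ℝ) := by
    refine sum_le_sum fun j _ => ?_
    calc _ ≤ renewal (m + 1 + j) * 1 :=
          mul_le_mul_of_nonneg_left (h_le_one _) (renewal_pos _).le
      _ ≤ 1 := by rw [mul_one]; exact renewal_le_one _
  rw [← sum_mul] at h1
  rw [sum_const, card_range, nsmul_eq_mul, mul_one] at h2
  push_cast at h2
  have h3 := mul_le_mul_of_nonneg_left (sqrt_div_exp_le_sum_renewal m) hδ0.le
  linarith

/-- Monotonicity of `h` turns `sum_renewal_mul_h` into `h n * ∑ renewal j ≤ 1`. -/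
theorem h_le (n : ℕ) (hn : 1 ≤ n) : h n ≤ Real.exp 1 * (1 / Real.sqrt n) := by
  have hsum := sum_renewal_mul_h n
  have h1 : ∑ j ∈ range (n + 1), renewal j * h n ≤ 1 := by
    rw [← hsum]
    exact sum_le_sum fun j _ =>
      mul_le_mul_of_nonneg_left (h_antitone (Nat.sub_le _ _)) (renewal_pos j).le
  rw [← sum_mul] at h1
  have h2 := mul_le_mul_of_nonneg_right (sqrt_div_exp_le_sum_renewal n) (h_pos n).le
  have hs : 0 < Real.sqrt n := Real.sqrt_pos.2 (by exact_mod_cast hn)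
  have h3 := h2.trans h1
  rw [div_mul_eq_mul_div, div_le_one (Real.exp_pos 1)] at h3
  rw [mul_one_div, le_div_iff₀ hs]
  linarith

/-- Since `h (2 n) > 0`, `h n` exceeds the sum of `borel` over `n + 1, …, 2 n`; these are `n` terms
of size at least `1 / (e √(2n) · 2n)`. -/
theorem le_h (n : ℕ) (hn : 1 ≤ n) :
    1 / (2 * Real.sqrt 2 * Real.exp 1) * (1 / Real.sqrt n) ≤ h n := by
  have hn0 : (0 : ℝ) < n := by exact_mod_cast hn
  have hdiff : ∀ m, h n - h (n + m) = ∑ j ∈ range m, borel (n + j + 1) := by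
    intro m
    induction m with
    | zero => simp
    | succ m ih => rw [sum_range_succ, ← ih, ← add_assoc, h_succ]; ring
  have h1 : ∑ _j ∈ range n, 1 / (Real.exp 1 * Real.sqrt (2 * n) * (2 * n)) ≤
      ∑ j ∈ range n, borel (n + j + 1) := by
    refine sum_le_sum fun j hj => ?_
    have hj' : ((n + j + 1 : ℕ) : ℝ) ≤ 2 * n := by
      have := mem_range.1 hj
      exact_mod_cast (by omega : n + j + 1 ≤ 2 * n)
    have hpos : (0 : ℝ) < ((n + j + 1 : ℕ) : ℝ) := by positivity
    rw [borel_eq, le_div_iff₀ hpos]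
    refine le_trans ?_ (one_div_le_renewal (by omega))
    rw [div_mul_eq_mul_div, one_mul, div_le_div_iff₀ (by positivity) (by positivity)]
    have hsq : Real.sqrt ((n + j + 1 : ℕ) : ℝ) ≤ Real.sqrt (2 * n) := Real.sqrt_le_sqrt hj'
    calc ((n + j + 1 : ℕ) : ℝ) * (Real.exp 1 * Real.sqrt ((n + j + 1 : ℕ) : ℝ))
        ≤ (2 * n) * (Real.exp 1 * Real.sqrt (2 * n)) := by gcongr
      _ = _ := by ring
  rw [← hdiff, sum_const, card_range, nsmul_eq_mul, Real.sqrt_mul (by norm_num)] at h1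
  have h2 : (n : ℝ) * (1 / (Real.exp 1 * (Real.sqrt 2 * Real.sqrt n) * (2 * n))) =
      1 / (2 * Real.sqrt 2 * Real.exp 1) * (1 / Real.sqrt n) := by
    have : 0 < Real.sqrt n := Real.sqrt_pos.2 hn0
    field_simp
  linarith [h_pos (n + n)]

theorem h_isTheta : Asymptotics.IsTheta Filter.atTop h (fun K : ℕ => 1 / Real.sqrt (K : ℝ)) := by
  constructor
  · refine Asymptotics.IsBigO.of_bound (Real.exp 1) ?_
    filter_upwards [Filter.eventually_ge_atTop 1] with n hn
    rw [Real.norm_of_nonneg (h_pos n).le, Real.norm_of_nonneg (by positivity)]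
    exact h_le n hn
  · refine Asymptotics.IsBigO.of_bound (2 * Real.sqrt 2 * Real.exp 1) ?_
    filter_upwards [Filter.eventually_ge_atTop 1] with n hn
    rw [Real.norm_of_nonneg (h_pos n).le, Real.norm_of_nonneg (by positivity)]
    have := le_h n hn
    rwa [one_div_mul_eq_div, div_le_iff₀' (by positivity)] at this

end RandomTree

namespace RandomTree

/-! ### Cuts of a connected graph by a single edge -/

section Cut

variable {V : Type*} {G : SimpleGraph V} {S S' : Set V} {r w r' w' : V}

/-- `r w` is the only edge of `G` between `S` and its complement, and `r ∈ S`. -/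
structure IsCut (G : SimpleGraph V) (S : Set V) (r w : V) : Prop where
  adj : G.Adj r w
  left_mem : r ∈ S
  right_notMem : w ∉ S
  eq_of_adj : ∀ x y, G.Adj x y → x ∈ S → y ∉ S → x = r ∧ y = w

theorem IsCut.compl (hc : IsCut G S r w) : IsCut G Sᶜ w r where
  adj := hc.adj.symm
  left_mem := hc.right_notMem
  right_notMem := fun h => h hc.left_mem
  eq_of_adj x y hxy hx hy := (hc.eq_of_adj y x hxy.symm (not_not.1 hy) hx).symm

theorem mem_of_reachable {P : Set V} (hP : ∀ x y, G.Adj x y → x ∈ P → y ∈ P) {x y : V}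
    (hxy : G.Reachable x y) (hx : x ∈ P) : y ∈ P := by
  obtain ⟨p⟩ := hxy
  induction p with
  | nil => exact hx
  | cons hadj _ ih => exact ih (hP _ _ hadj hx)

/-- A walk from `r` that leaves `S` can re-enter it only at `r`. The invariant carried along the
walk is vacuous outside `S`. -/
theorem IsCut.connected_induce (hc : IsCut G S r w) (hG : G.Connected) :
    (G.induce S).Connected := by
  have key : ∀ x : V, x ∈ {x | ∀ hx : x ∈ S, (G.induce S).Reachable ⟨r, hc.left_mem⟩ ⟨x, hx⟩} := by
    intro x
    refine mem_of_reachable (G := G) ?_ (hG.preconnected r x) fun _ => SimpleGraph.Reachable.refl _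
    intro x y hxy hx hy
    by_cases hxS : x ∈ S
    · exact (hx hxS).trans (SimpleGraph.Adj.reachable (by simpa using hxy))
    · obtain ⟨rfl, rfl⟩ := hc.eq_of_adj y x hxy.symm hy hxS
      rfl
  have : Nonempty S := ⟨⟨r, hc.left_mem⟩⟩
  exact ⟨fun x y => (key x x.2).symm.trans (key y y.2)⟩

theorem IsCut.isTree_induce (hc : IsCut G S r w) (hG : G.IsTree) : (G.induce S).IsTree :=
  ⟨hc.connected_induce hG.connected, hG.isAcyclic.induce S⟩

/-- A set that is not separated by an edge inside one side of a cut contains that side or is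
disjoint from it. -/
theorem IsCut.subset_or_disjoint (hc : IsCut G S r w) (hG : G.Connected) {P : Set V}
    (hP : ∀ x y, x ∈ S → y ∈ S → G.Adj x y → x ∈ P → y ∈ P) : S ⊆ P ∨ Disjoint S P := by
  rw [or_iff_not_imp_right, Set.not_disjoint_iff]
  rintro ⟨x, hxS, hxP⟩ y hy
  exact mem_of_reachable (G := G.induce S) (P := Subtype.val ⁻¹' P)
    (fun a b hab ha => hP a b a.2 b.2 (by simpa using hab) ha)
    ((hc.connected_induce hG).preconnected ⟨x, hxS⟩ ⟨y, hy⟩) hxP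

/-- The edge `r' w'` cannot lie inside both `S` and `Sᶜ`. A side that does not contain it is not
separated by `S'`, so it is contained in `S'` or disjoint from it. -/
theorem IsCut.nested_or_disjoint (hc : IsCut G S r w) (hc' : IsCut G S' r' w')
    (hG : G.Connected) : S ⊆ S' ∨ S' ⊆ S ∨ Disjoint S S' ∨ Sᶜ ⊆ S' := by
  by_cases hin : r' ∈ S ∧ w' ∈ S
  · have := hc.compl.subset_or_disjoint hG (P := S') fun x y hx _ hxy hx' => by
      by_contra hy'
      exact hx ((hc'.eq_of_adj x y hxy hx' hy').1 ▸ hin.1)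
    rcases this with h | h
    · exact Or.inr (Or.inr (Or.inr h))
    · exact Or.inr (Or.inl (Set.disjoint_compl_left_iff_subset.1 h))
  · have := hc.subset_or_disjoint hG (P := S') fun x y hx hy hxy hx' => by
      by_contra hy'
      obtain ⟨rfl, rfl⟩ := hc'.eq_of_adj x y hxy hx' hy'
      exact hin ⟨hx, hy⟩
    tauto

theorem IsCut.edge_unique (hc : IsCut G S r w) (hc' : IsCut G S r' w') : r = r' ∧ w = w' :=
  hc'.eq_of_adj r w hc.adj hc.left_mem hc.right_notMem

/-- The edge `r w` does not lie inside `Sᶜ`, so `Sᶜ` is contained in `S'` or disjoint from it; the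
vertex `w` rules out the first. -/
theorem IsCut.subset_of_edge (hc : IsCut G S r w) (hc' : IsCut G S' r w) (hG : G.Connected) :
    S' ⊆ S := by
  have := hc.compl.subset_or_disjoint hG (P := S') fun x y hx _ hxy hx' => by
    by_contra hy'
    exact hx ((hc'.eq_of_adj x y hxy hx' hy').1 ▸ hc.left_mem)
  rcases this with h | h
  · exact absurd (h hc.right_notMem) hc'.right_notMem
  · exact Set.disjoint_compl_left_iff_subset.1 h

theorem IsCut.side_unique (hc : IsCut G S r w) (hc' : IsCut G S' r w) (hG : G.Connected) :
    S = S' :=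
  (hc'.subset_of_edge hc hG).antisymm (hc.subset_of_edge hc' hG)

theorem IsCut.right_unique_of_subset (hc : IsCut G S r w) (hc' : IsCut G S' r w')
    (hSS' : S ⊆ S') : w = w' :=
  (hc.eq_of_adj r w' hc'.adj hc.left_mem fun h => hc'.right_notMem (hSS' h)).2.symm

/-- Each edge of an acyclic graph is a cut edge. -/
theorem isCut_of_adj (hG : G.IsAcyclic) (hrw : G.Adj r w) :
    IsCut G {u | (G.deleteEdges {s(r, w)}).Reachable r u} r w where
  adj := hrw
  left_mem := SimpleGraph.Reachable.refl _
  right_notMem := by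
    have := SimpleGraph.isAcyclic_iff_forall_adj_isBridge.1 hG hrw
    rwa [SimpleGraph.isBridge_iff] at this
  eq_of_adj := by
    intro x y hxy hx hy
    have hw : ¬ (G.deleteEdges {s(r, w)}).Reachable r w := by
      have := SimpleGraph.isAcyclic_iff_forall_adj_isBridge.1 hG hrw
      rwa [SimpleGraph.isBridge_iff] at this
    by_contra hne
    by_cases hs : s(x, y) = s(r, w)
    · rcases Sym2.eq_iff.1 hs with h | ⟨rfl, rfl⟩
      · exact hne h
      · exact hw hx
    · exact hy (hx.trans (SimpleGraph.Adj.reachable (by simp [SimpleGraph.deleteEdges_adj, hxy, hs])))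

/-! ### Trees with a prescribed cut -/

theorem isTree_sum_sup_edge {α β : Type*} [Finite α] [Finite β] {A : SimpleGraph α}
    {B : SimpleGraph β} (hA : A.IsTree) (hB : B.IsTree) (a : α) (b : β) :
    (A.sum B ⊔ SimpleGraph.edge (Sum.inl a) (Sum.inr b)).IsTree := by
  classical
  have := Fintype.ofFinite α
  have := Fintype.ofFinite β
  rw [SimpleGraph.isTree_iff_connected_and_card] at hA hB ⊢
  refine ⟨hA.1.sum_sup_edge hB.1, ?_⟩
  have h1 := Nat.card_congr (SimpleGraph.edgeSetSumEquiv (G := A) (H := B))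
  rw [Nat.card_sum] at h1
  have h2 := SimpleGraph.card_edgeFinset_sup_edge (A.sum B) (s := Sum.inl a) (t := Sum.inr b)
    (by simp) (by simp)
  rw [← SimpleGraph.coe_edgeFinset, Nat.card_coe_set_eq, Set.ncard_coe_finset] at h1
  rw [← SimpleGraph.coe_edgeFinset, Nat.card_coe_set_eq, Set.ncard_coe_finset, h2, h1, Nat.card_sum]
  omega

/-- A graph is determined by a cut and the graphs induced on its two sides. -/
theorem IsCut.ext {H : SimpleGraph V} (hc : IsCut G S r w) (hd : IsCut H S r w)
    (h : G.induce S = H.induce S) (h' : G.induce Sᶜ = H.induce Sᶜ) : G = H := by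
  have key : ∀ {G H : SimpleGraph V}, IsCut G S r w → IsCut H S r w →
      G.induce S = H.induce S → G.induce Sᶜ = H.induce Sᶜ → ∀ x y, G.Adj x y → H.Adj x y := by
    intro G H hc hd h h' x y hxy
    by_cases hx : x ∈ S <;> by_cases hy : y ∈ S
    · have : (H.induce S).Adj ⟨x, hx⟩ ⟨y, hy⟩ := h ▸ hxy
      exact this
    · obtain ⟨rfl, rfl⟩ := hc.eq_of_adj _ _ hxy hx hy
      exact hd.adj
    · obtain ⟨rfl, rfl⟩ := hc.eq_of_adj _ _ hxy.symm hy hx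
      exact hd.adj.symm
    · have : (H.induce Sᶜ).Adj ⟨x, hx⟩ ⟨y, hy⟩ := h' ▸ hxy
      exact this
  ext x y
  exact ⟨key hc hd h h' x y, key hd hc h.symm h'.symm x y⟩

/-- Cutting an edge identifies the trees with a given cut with pairs of trees. -/
theorem card_isTree_isCut [Finite V] (S : Set V) (hr : r ∈ S) (hw : w ∉ S) :
    Nat.card {G : SimpleGraph V // G.IsTree ∧ IsCut G S r w} =
      Nat.card {A : SimpleGraph S // A.IsTree} *
        Nat.card {B : SimpleGraph (Sᶜ : Set V) // B.IsTree} := by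
  classical
  rw [← Nat.card_prod]
  refine Nat.card_congr (Equiv.ofBijective (fun G => (⟨G.1.induce S, G.2.2.isTree_induce G.2.1⟩,
    ⟨G.1.induce Sᶜ, G.2.2.compl.isTree_induce G.2.1⟩)) ⟨?_, ?_⟩)
  · rintro ⟨G, hG, hc⟩ ⟨H, hH, hd⟩ heq
    simp only [Prod.mk.injEq, Subtype.mk.injEq] at heq ⊢
    exact hc.ext hd heq.1 heq.2
  · rintro ⟨⟨A, hA⟩, ⟨B, hB⟩⟩
    set J := A.sum B ⊔ SimpleGraph.edge (Sum.inl ⟨r, hr⟩) (Sum.inr ⟨w, hw⟩) with hJ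
    have hJt : J.IsTree := isTree_sum_sup_edge hA hB _ _
    set e := (Equiv.Set.sumCompl S).symm
    have he : ∀ x (hx : x ∈ S), e x = Sum.inl ⟨x, hx⟩ := fun x hx =>
      Equiv.Set.sumCompl_symm_apply_of_mem hx
    have he' : ∀ x (hx : x ∉ S), e x = Sum.inr ⟨x, hx⟩ := fun x hx =>
      Equiv.Set.sumCompl_symm_apply_of_notMem hx
    refine ⟨⟨J.comap e, (SimpleGraph.Iso.comap e J).isTree_iff.2 hJt, ?_⟩, ?_⟩
    · refine ⟨?_, hr, hw, ?_⟩
      · rw [SimpleGraph.comap_adj, he r hr, he' w hw, hJ]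
        simp [SimpleGraph.edge_adj]
      · intro x y hxy hx hy
        rw [SimpleGraph.comap_adj, he x hx, he' y hy, hJ] at hxy
        simpa [SimpleGraph.edge_adj] using hxy
    · simp only [Prod.mk.injEq, Subtype.mk.injEq]
      constructor
      · ext x y
        simp [he x x.2, he y y.2, hJ, SimpleGraph.edge_adj]
      · ext x y
        simp [he' x x.2, he' y y.2, hJ, SimpleGraph.edge_adj]

end Cut
end RandomTree

namespace RandomTree

open Finset

/-! ### Cayley's formula -/

section Cayley

universe u

variable {V : Type u}

/-- The trees on the vertex set `V`. -/
noncomputable def trees (V : Type u) [Finite V] : Finset (SimpleGraph V) :=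
  (Set.toFinite {G : SimpleGraph V | G.IsTree}).toFinset

@[simp] theorem mem_trees [Finite V] {G : SimpleGraph V} : G ∈ trees V ↔ G.IsTree := by
  simp [trees]

/-- The triples `(S, r, w)` such that `r w` cuts off `S` from `G`. -/
noncomputable def cuts [Finite V] (G : SimpleGraph V) : Finset (Finset V × V × V) :=
  (Set.toFinite {c : Finset V × V × V | IsCut G c.1 c.2.1 c.2.2}).toFinset

@[simp] theorem mem_cuts [Finite V] {G : SimpleGraph V} {c : Finset V × V × V} :
    c ∈ cuts G ↔ IsCut G c.1 c.2.1 c.2.2 := by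
  simp [cuts]

theorem card_trees_eq [Finite V] : #(trees V) = Nat.card {G : SimpleGraph V // G.IsTree} := by
  rw [← Nat.card_eq_finsetCard]
  exact Nat.card_congr (Equiv.subtypeEquivRight fun _ => mem_trees)

/-- The number of trees on `n` labelled vertices, see `card_trees`. -/
noncomputable def treeCount (n : ℕ) : ℝ := (n : ℝ) ^ n / (n : ℝ) ^ 2

open Classical in
theorem card_filter_isCut [Finite V] (S : Finset V) {r w : V} (hr : r ∈ S) (hw : w ∉ S) :
    #{G ∈ trees V | IsCut G S r w} = #(trees S) * #(trees ((S : Set V)ᶜ : Set V)) := by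
  have h := card_isTree_isCut (S : Set V) (r := r) (w := w) (by simpa) (by simpa)
  rw [card_trees_eq, card_trees_eq]
  refine Eq.trans ?_ h
  rw [← Nat.card_eq_finsetCard]
  exact Nat.card_congr (Equiv.subtypeEquivRight fun _ => by simp)

/-- Cuts of a tree correspond to its oriented edges: the pair `(r, w)` determines the side `S`. -/
theorem card_cuts [Fintype V] {G : SimpleGraph V} (hG : G.IsTree) :
    #(cuts G) + 2 = 2 * Fintype.card V := by
  classical
  have h1 : #(cuts G) = Fintype.card G.Dart := by
    rw [← Fintype.card_coe]
    refine Fintype.card_congr (Equiv.ofBijective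
      (fun c => ⟨(c.1.2.1, c.1.2.2), (mem_cuts.1 c.2).adj⟩) ⟨?_, ?_⟩)
    · rintro ⟨⟨S, r, w⟩, hc⟩ ⟨⟨S', r', w'⟩, hc'⟩ heq
      simp only [SimpleGraph.Dart.mk.injEq, Prod.mk.injEq] at heq
      obtain ⟨rfl, rfl⟩ := heq
      obtain rfl : S = S' :=
        coe_injective (IsCut.side_unique (mem_cuts.1 hc)
          (mem_cuts (c := (S', r, w)).1 hc') hG.connected)
      rfl
    · rintro ⟨⟨r, w⟩, hrw⟩
      refine ⟨⟨(Set.toFinset {u | (G.deleteEdges {s(r, w)}).Reachable r u}, r, w), ?_⟩, rfl⟩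
      rw [mem_cuts]
      simpa using isCut_of_adj hG.isAcyclic hrw
  have h2 := G.dart_card_eq_twice_card_edges
  have h3 := hG.card_edgeFinset
  omega

/-- Double counting of the pairs of a tree and one of its cuts. -/
theorem sum_trees_sum_cuts [Fintype V] (f : ℕ → ℝ) :
    ∑ G ∈ trees V, ∑ c ∈ cuts G, f #c.1 =
      ∑ S : Finset V, f #S * (#S * ((Fintype.card V - #S : ℕ) : ℝ) *
        (#(trees S) * #(trees ((S : Set V)ᶜ : Set V)))) := by
  classical
  have h1 : ∑ G ∈ trees V, ∑ c ∈ cuts G, f #c.1 =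
      ∑ c : Finset V × V × V, ∑ G ∈ trees V with IsCut G c.1 c.2.1 c.2.2, f #c.1 := by
    refine sum_comm' fun G c => ?_
    simp
  rw [h1, Fintype.sum_prod_type]
  refine sum_congr rfl fun S _ => ?_
  have h2 : ∀ p : V × V, ∑ G ∈ trees V with IsCut G S p.1 p.2, f #S =
      if p ∈ S ×ˢ Sᶜ then f #S * (#(trees S) * #(trees ((S : Set V)ᶜ : Set V))) else 0 := by
    rintro ⟨r, w⟩
    rw [sum_const, nsmul_eq_mul]
    split_ifs with hp
    · rw [mem_product, mem_compl] at hp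
      rw [card_filter_isCut S hp.1 hp.2]; push_cast; ring
    · rw [filter_eq_empty_iff.2, card_empty, Nat.cast_zero, zero_mul]
      intro G _ hc
      exact hp (mem_product.2 ⟨by simpa using hc.left_mem, by simpa using hc.right_notMem⟩)
  simp only [h2]
  rw [sum_ite_mem, univ_inter, sum_const, card_product, card_compl, nsmul_eq_mul]
  push_cast
  ring

/-- This is the number of rooted trees. Writing powers as quotients gives the right values 0 for `k
= 0` and 1 for `k = 1`, which truncated exponents would not. -/
theorem natCast_mul_treeCount (k : ℕ) : (k : ℝ) * treeCount k = (k : ℝ) ^ k / k := by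
  rcases Nat.eq_zero_or_pos k with rfl | hk
  · simp
  · have : (k : ℝ) ≠ 0 := by positivity
    rw [treeCount]; field_simp

/-- Multiply by `n = k + (n - k)`: with `a k = k ^ (k - 1)`, each half turns one factor `a` into a
full power, so the sum becomes two copies of Abel's identity, up to boundary terms. -/
theorem sum_choose_mul_treeCount {n : ℕ} (hn : 1 ≤ n) :
    ∑ k ∈ range (n + 1), (n.choose k : ℝ) *
      (k * ((n - k : ℕ) : ℝ) * (treeCount k * treeCount (n - k))) =
      2 * (n - 1) * treeCount n := by
  have hn0 : (n : ℝ) ≠ 0 := by positivity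
  have habel := sum_choose_mul_pow_div_mul_pow hn
  have habel' := habel
  rw [← sum_range_reflect] at habel'
  set a : ℕ → ℝ := fun k => (k : ℝ) ^ k / k with ha
  -- The correction is `0 ^ 0 = 1` against `a 0 = 0`; it produces the two boundary terms `a n`.
  have hak : ∀ k : ℕ, a k * k = (k : ℝ) ^ k - if k = 0 then 1 else 0 := by
    intro k
    rcases Nat.eq_zero_or_pos k with rfl | hk
    · simp
    · have : (k : ℝ) ≠ 0 := by positivity
      simp [ha, hk.ne', this]
  have hterm : ∀ k ∈ range (n + 1), n * ((n.choose k : ℝ) *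
      (k * ((n - k : ℕ) : ℝ) * (treeCount k * treeCount (n - k)))) =
      (n.choose k : ℝ) * a k * ((n - k : ℕ) : ℝ) ^ (n - k) +
        (n.choose (n - k) : ℝ) * a (n - k) * ((n - (n - k) : ℕ) : ℝ) ^ (n - (n - k)) -
        ((if k = n then a n else 0) + if k = 0 then a n else 0) := by
    intro k hk
    have hk' : k ≤ n := by simpa [Nat.lt_succ_iff] using hk
    have e1 : (k * ((n - k : ℕ) : ℝ) * (treeCount k * treeCount (n - k))) =
        a k * a (n - k) := by
      simp only [ha]
      rw [← natCast_mul_treeCount k, ← natCast_mul_treeCount (n - k)]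
      ring
    have e2 : (n : ℝ) = k + ((n - k : ℕ) : ℝ) := by rw [Nat.cast_sub hk']; ring
    have e3 : (n.choose k : ℝ) * a k * (if n - k = 0 then 1 else 0) = if k = n then a n else 0 := by
      by_cases h : k = n
      · subst h; simp
      · rw [if_neg (by omega), if_neg h, mul_zero]
    have e4 : (n.choose k : ℝ) * a (n - k) * (if k = 0 then 1 else 0) = if k = 0 then a n else 0 := by
      by_cases h : k = 0
      · subst h; simp
      · rw [if_neg h, if_neg h, mul_zero]
    rw [e1, Nat.choose_symm hk', Nat.sub_sub_self hk', ← e3, ← e4]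
    have h1 := hak k
    have h2 := hak (n - k)
    calc (n : ℝ) * ((n.choose k : ℝ) * (a k * a (n - k)))
        = (n.choose k : ℝ) * a k * (a (n - k) * ((n - k : ℕ) : ℝ)) +
            (n.choose k : ℝ) * a (n - k) * (a k * k) := by
          conv_lhs => rw [e2]
          ring
      _ = _ := by rw [h1, h2]; ring
  have hsum : n * ∑ k ∈ range (n + 1), (n.choose k : ℝ) *
      (k * ((n - k : ℕ) : ℝ) * (treeCount k * treeCount (n - k))) =
      2 * (n : ℝ) ^ n - 2 * a n := by
    rw [mul_sum, sum_congr rfl hterm, sum_sub_distrib, sum_add_distrib, sum_add_distrib, habel,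
      sum_ite_eq', sum_ite_eq', if_pos (by simp), if_pos (by simp)]
    have e : ∑ k ∈ range (n + 1), (n.choose (n - k) : ℝ) * a (n - k) *
        ((n - (n - k) : ℕ) : ℝ) ^ (n - (n - k)) = (n : ℝ) ^ n := by
      rw [← habel']
      refine sum_congr rfl fun k hk => ?_
      rw [Nat.add_sub_cancel]
    rw [e]; ring
  rw [← mul_right_inj' hn0, hsum]
  simp only [ha, treeCount]
  field_simp

/-- **Cayley's formula.** -/
theorem card_trees (V : Type u) [Fintype V] : (#(trees V) : ℝ) = treeCount (Fintype.card V) := by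
  classical
  induction hn : Fintype.card V using Nat.strong_induction_on generalizing V with
  | _ n ih =>
    rcases Nat.lt_or_ge n 2 with hlt | hge
    · interval_cases n
      · have : IsEmpty V := Fintype.card_eq_zero_iff.1 hn
        rw [treeCount, eq_empty_of_forall_notMem (s := trees V)]
        · simp
        · intro G hG
          rw [mem_trees] at hG
          exact not_isEmpty_iff.2 hG.connected.nonempty this
      · obtain ⟨x, hx⟩ := Fintype.card_eq_one_iff.1 hn
        have : Subsingleton V := ⟨fun a b => (hx a).trans (hx b).symm⟩
        have : Nonempty V := ⟨x⟩
        have h1 : trees V = {⊥} := by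
          ext G
          simp only [mem_trees, mem_singleton]
          refine ⟨fun _ => ?_, fun h => SimpleGraph.IsTree.of_subsingleton⟩
          ext a b
          simp [Subsingleton.elim a b]
        simp [h1, treeCount]
    -- Every tree has `2 (n - 1)` cuts, so counting all cuts in two ways expresses the number of
    -- trees through smaller ones. Empty and full `S` carry a zero factor, so the induction
    -- hypothesis is needed only for smaller sizes.
    · have h1 := sum_trees_sum_cuts (V := V) (fun _ => 1)
      have h2 : ∀ G ∈ trees V, ∑ _c ∈ cuts G, (1 : ℝ) = 2 * (n - 1) := by
        intro G hG
        have := card_cuts (mem_trees.1 hG)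
        rw [hn] at this
        have h' : (#(cuts G) : ℝ) + 2 = 2 * n := by exact_mod_cast this
        rw [sum_const, nsmul_eq_mul, mul_one]; linarith
      rw [sum_congr rfl h2, sum_const, nsmul_eq_mul, hn] at h1
      have h3 : ∀ S : Finset V, (1 : ℝ) * (#S * ((n - #S : ℕ) : ℝ) *
          (#(trees S) * #(trees ((S : Set V)ᶜ : Set V)))) =
          #S * ((n - #S : ℕ) : ℝ) * (treeCount #S * treeCount (n - #S)) := by
        intro S
        have hS : #S ≤ n := hn ▸ card_le_univ S
        rcases Nat.eq_zero_or_pos #S with h0 | h0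
        · simp [h0]
        rcases hS.eq_or_lt with h0' | h0'
        · simp [h0']
        have hc : Fintype.card ((S : Set V)ᶜ : Set V) = n - #S := by
          rw [Fintype.card_compl_set, hn]; simp
        rw [ih _ h0' S (by simp), ih (n - #S) (by omega) _ hc, one_mul]
      simp only [h3] at h1
      rw [← powerset_univ, sum_powerset_apply_card (fun k => (k : ℝ) * ((n - k : ℕ) : ℝ) *
          (treeCount k * treeCount (n - k))), card_univ, hn] at h1
      simp only [nsmul_eq_mul] at h1
      rw [sum_choose_mul_treeCount (by omega)] at h1
      have hpos : (2 * (n - 1) : ℝ) ≠ 0 := by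
        have : (2 : ℝ) ≤ n := by exact_mod_cast hge
        nlinarith
      rw [mul_comm] at h1
      exact mul_left_cancel₀ hpos h1

/-- The total number of pairs of a tree and one of its cuts, weighted by the size of the part that
is cut off. -/
theorem sum_trees_sum_cuts_eq [Fintype V] (f : ℕ → ℝ) :
    ∑ G ∈ trees V, ∑ c ∈ cuts G, f #c.1 =
      ∑ k ∈ range (Fintype.card V + 1), ((Fintype.card V).choose k : ℝ) *
        (f k * (k * ((Fintype.card V - k : ℕ) : ℝ) *
          (treeCount k * treeCount (Fintype.card V - k)))) := by
  classical
  rw [sum_trees_sum_cuts]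
  have h3 : ∀ S : Finset V, f #S * (#S * ((Fintype.card V - #S : ℕ) : ℝ) *
      (#(trees S) * #(trees ((S : Set V)ᶜ : Set V)))) =
      f #S * (#S * ((Fintype.card V - #S : ℕ) : ℝ) *
        (treeCount #S * treeCount (Fintype.card V - #S))) := by
    intro S
    rw [card_trees, card_trees, Fintype.card_compl_set]
    simp
  simp only [h3]
  rw [← powerset_univ, sum_powerset_apply_card (fun k => f k * ((k : ℝ) *
    ((Fintype.card V - k : ℕ) : ℝ) * (treeCount k * treeCount (Fintype.card V - k)))), card_univ]
  simp only [nsmul_eq_mul]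

end Cayley
end RandomTree

namespace RandomTree

open Finset

/-! ### The first two moments of the number of small cuts -/

section Moments

universe u

variable {V : Type u}

open Classical in
/-- The cuts of `G` that cut off at most `K` vertices. -/
noncomputable def smallCuts [Finite V] (K : ℕ) (G : SimpleGraph V) : Finset (Finset V × V × V) :=
  {c ∈ cuts G | #c.1 ≤ K}

theorem mem_smallCuts [Finite V] {K : ℕ} {G : SimpleGraph V} {c : Finset V × V × V} :
    c ∈ smallCuts K G ↔ IsCut G c.1 c.2.1 c.2.2 ∧ #c.1 ≤ K := by
  simp [smallCuts]

theorem sum_card_smallCuts [Fintype V] {K : ℕ} (hK : K ≤ Fintype.card V) :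
    ∑ G ∈ trees V, (#(smallCuts K G) : ℝ) =
      ∑ k ∈ range (K + 1), ((Fintype.card V).choose k : ℝ) *
        (k * ((Fintype.card V - k : ℕ) : ℝ) * (treeCount k * treeCount (Fintype.card V - k))) := by
  have h := sum_trees_sum_cuts_eq (V := V) (fun k => if k ≤ K then 1 else 0)
  have h1 : ∀ G : SimpleGraph V, (#(smallCuts K G) : ℝ) =
      ∑ c ∈ cuts G, if #c.1 ≤ K then (1 : ℝ) else 0 := by
    intro G
    rw [sum_boole, smallCuts]
  simp only [h1]
  rw [h, ← sum_subset (range_mono (Nat.succ_le_succ hK))]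
  · refine sum_congr rfl fun k hk => ?_
    rw [if_pos (Nat.lt_succ_iff.1 (mem_range.1 hk)), one_mul]
  · intro k _ hk
    rw [if_neg (by simpa [Nat.lt_succ_iff] using hk), zero_mul, mul_zero]

/-- The remaining possibility, that the complement of one part lies in the other, would require `n -
K ≤ K`. -/
theorem small_nested_or_disjoint [Fintype V] {K : ℕ} (hK : 2 * K < Fintype.card V)
    {G : SimpleGraph V} (hG : G.Connected) {c c' : Finset V × V × V} (hc : c ∈ smallCuts K G)
    (hc' : c' ∈ smallCuts K G) : c.1 ⊆ c'.1 ∨ c'.1 ⊆ c.1 ∨ Disjoint c.1 c'.1 := by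
  classical
  rw [mem_smallCuts] at hc hc'
  rcases hc.1.nested_or_disjoint hc'.1 hG with h | h | h | h
  · exact Or.inl (by exact_mod_cast h)
  · exact Or.inr (Or.inl (by exact_mod_cast h))
  · exact Or.inr (Or.inr (by exact_mod_cast h))
  · rw [← coe_compl, coe_subset] at h
    have := card_le_card h
    rw [card_compl] at this
    omega

theorem eq_of_fst_eq {G : SimpleGraph V} {c c' : Finset V × V × V}
    (hc : IsCut G c.1 c.2.1 c.2.2) (hc' : IsCut G c'.1 c'.2.1 c'.2.2) (h : c.1 = c'.1) :
    c = c' := by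
  rw [← h] at hc'
  have := hc.edge_unique hc'
  exact Prod.ext h (Prod.ext this.1 this.2)

open Classical in
/-- Few small cuts intersect a given one. -/
theorem card_smallCuts_not_disjoint_le [Fintype V] {K : ℕ} (hK : 2 * K < Fintype.card V)
    {G : SimpleGraph V} (hG : G.Connected) {c : Finset V × V × V} (hc : c ∈ smallCuts K G) :
    #{c' ∈ smallCuts K G | ¬ Disjoint c.1 c'.1} ≤ K * (K + 1) := by
  have hsub : {c' ∈ smallCuts K G | ¬ Disjoint c.1 c'.1} ⊆
      (c.1 ×ˢ range (K + 1)).biUnion fun p => {c' ∈ smallCuts K G | p.1 ∈ c'.1 ∧ #c'.1 = p.2} := by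
    intro c' hc'
    rw [mem_filter, not_disjoint_iff] at hc'
    obtain ⟨h1, x, hx, hx'⟩ := hc'
    rw [mem_biUnion]
    refine ⟨(x, #c'.1), ?_, ?_⟩
    · rw [mem_product, mem_range, Nat.lt_succ_iff]
      exact ⟨hx, (mem_smallCuts.1 h1).2⟩
    · rw [mem_filter]
      exact ⟨h1, hx', rfl⟩
  refine (card_le_card hsub).trans ((card_biUnion_le_card_mul _ _ 1 ?_).trans ?_)
  -- Small parts containing a common vertex form a chain, so at most one of them has a given size.
  · rintro ⟨x, s⟩ _
    refine card_le_one.2 fun a ha b hb => ?_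
    rw [mem_filter] at ha hb
    refine eq_of_fst_eq (mem_smallCuts.1 ha.1).1 (mem_smallCuts.1 hb.1).1 ?_
    rcases small_nested_or_disjoint hK hG ha.1 hb.1 with h | h | h
    · exact eq_of_subset_of_card_le h (by rw [ha.2.2, hb.2.2])
    · exact (eq_of_subset_of_card_le h (by rw [ha.2.2, hb.2.2])).symm
    · exact absurd hb.2.1 (disjoint_left.1 h ha.2.1)
  · rw [card_product, card_range, mul_one]
    exact Nat.mul_le_mul_right _ (mem_smallCuts.1 hc).2

open Classical in
/-- An upper bound for the number of trees with two prescribed disjoint small cuts. -/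
theorem card_filter_isCut_isCut_le [Fintype V] {K : ℕ} (hK : 2 * K < Fintype.card V)
    {S S' : Finset V} (hS : #S ≤ K) (hS' : #S' ≤ K) (hd : Disjoint S S') (r w r' w' : V) :
    (#{G ∈ trees V | IsCut G S r w ∧ IsCut G S' r' w'} : ℝ) ≤
      treeCount #S * treeCount #S' * treeCount (Fintype.card V - (#S + #S')) := by
  rcases ({G ∈ trees V | IsCut G S r w ∧ IsCut G S' r' w'}).eq_empty_or_nonempty with h0 | ⟨G, hG⟩
  · rw [h0, card_empty, Nat.cast_zero]
    unfold treeCount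
    positivity
  rw [mem_filter, mem_trees] at hG
  obtain ⟨hGt, hc, hc'⟩ := hG
  have hr' : r' ∉ S := fun h => disjoint_left.1 hd h (by simpa using hc'.left_mem)
  -- Otherwise the edge `r' w'` enters `S`, so the complement of `S` is not separated by `S'`; it
  -- would then lie in `S'`, which is too small, or miss `r'`.
  have hw' : w' ∉ S := by
    intro hw'
    have := hc.compl.subset_or_disjoint hGt.connected (P := (S' : Set V))
      fun x y _ hy hxy hx' => by
        by_contra hy'
        exact hy ((hc'.eq_of_adj x y hxy hx' hy').2 ▸ (by simpa using hw'))
    rcases this with h | h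
    · rw [← coe_compl, coe_subset] at h
      have := card_le_card h
      rw [card_compl] at this
      omega
    · exact Set.disjoint_left.1 h (by simpa using hr') hc'.left_mem
  set U : Finset ((S : Set V)ᶜ : Set V) := S'.subtype (· ∈ (S : Set V)ᶜ) with hU
  have hUc : #U = #S' := by
    rw [hU, card_subtype, filter_true_of_mem]
    intro x hx
    simpa using disjoint_right.1 hd hx
  have hmemU : ∀ x : ((S : Set V)ᶜ : Set V), x ∈ (U : Set _) ↔ (x : V) ∈ (S' : Set V) := by
    intro x
    simp [hU]
  -- Cutting off `S` leaves a tree on the complement, in which `S'` is still a cut part. An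
  -- injection suffices for the upper bound, and the target is counted by cutting once more.
  have hle : #{G ∈ trees V | IsCut G S r w ∧ IsCut G S' r' w'} ≤
      #(trees (S : Set V) ×ˢ {B ∈ trees ((S : Set V)ᶜ : Set V) |
        IsCut B U ⟨r', by simpa using hr'⟩ ⟨w', by simpa using hw'⟩}) := by
    refine card_le_card_of_injOn (fun G => (G.induce (S : Set V), G.induce (S : Set V)ᶜ)) ?_ ?_
    · intro G hG
      simp only [coe_filter, mem_trees, Set.mem_ofPred_eq] at hG
      obtain ⟨hGt, hc, hc'⟩ := hG
      simp only [coe_product, Set.mem_prod, mem_coe, mem_trees, mem_filter]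
      refine ⟨hc.isTree_induce hGt, hc.compl.isTree_induce hGt, hc'.adj, ?_, ?_, ?_⟩
      · exact (hmemU _).2 hc'.left_mem
      · exact fun h => hc'.right_notMem ((hmemU _).1 h)
      · intro x y hxy hx hy
        obtain ⟨h1, h2⟩ := hc'.eq_of_adj x y hxy ((hmemU x).1 hx) fun h => hy ((hmemU y).2 h)
        exact ⟨Subtype.ext h1, Subtype.ext h2⟩
    · intro G hG H hH heq
      simp only [coe_filter, mem_trees, Set.mem_ofPred_eq] at hG hH
      simp only [Prod.mk.injEq] at heq
      exact hG.2.1.ext hH.2.1 heq.1 heq.2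
  have hcard : (#(trees (S : Set V) ×ˢ {B ∈ trees ((S : Set V)ᶜ : Set V) |
        IsCut B U ⟨r', by simpa using hr'⟩ ⟨w', by simpa using hw'⟩}) : ℝ) =
      treeCount #S * treeCount #S' * treeCount (Fintype.card V - (#S + #S')) := by
    rw [card_product, card_filter_isCut U ((hmemU _).2 hc'.left_mem)
      (fun h => hc'.right_notMem ((hmemU ⟨w', by simpa using hw'⟩).1 h))]
    push_cast
    rw [card_trees, card_trees, card_trees, Fintype.card_compl_set, Fintype.card_compl_set]
    simp only [coe_sort_coe, Fintype.card_coe, hUc, Nat.sub_sub]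
    ring
  rw [← hcard]
  exact_mod_cast hle

-- Here `w` ranges over all vertices, not only those outside the part. In the second moment bound
-- this overcount costs nothing to leading order.
open Classical in
theorem sum_ite_mem_fst [Fintype V] (φ : ℕ → ℝ) :
    ∑ c : Finset V × V × V, (if c.2.1 ∈ c.1 then φ #c.1 else 0) =
      ∑ k ∈ range (Fintype.card V + 1), ((Fintype.card V).choose k : ℝ) *
        (k * Fintype.card V * φ k) := by
  have h1 : ∀ S : Finset V, ∑ p : V × V, (if p.1 ∈ S then φ #S else 0) =
      #S * Fintype.card V * φ #S := by
    intro S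
    have e : ({p : V × V | p.1 ∈ S} : Finset _) = S ×ˢ univ := by ext p; simp
    rw [← sum_filter, e, sum_const, card_product, card_univ, nsmul_eq_mul]
    push_cast
    ring
  rw [Fintype.sum_prod_type]
  have h2 : ∀ S : Finset V, ∑ p : V × V, (if (S, p).2.1 ∈ (S, p).1 then φ #(S, p).1 else 0) =
      #S * Fintype.card V * φ #S := by
    intro S
    rw [← h1 S]
  rw [sum_congr rfl fun S _ => h2 S, ← powerset_univ,
    sum_powerset_apply_card (fun k => (k : ℝ) * Fintype.card V * φ k), card_univ]
  simp only [nsmul_eq_mul]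

open Classical in
theorem sum_card_disjoint_le [Fintype V] {K : ℕ} (hK : 2 * K < Fintype.card V) :
    ∑ G ∈ trees V, (#{p ∈ smallCuts K G ×ˢ smallCuts K G | Disjoint p.1.1 p.2.1} : ℝ) ≤
      ∑ k ∈ range (K + 1), ∑ l ∈ range (K + 1),
        ((Fintype.card V).choose k : ℝ) * (k * Fintype.card V) *
        (((Fintype.card V).choose l : ℝ) * (l * Fintype.card V)) *
        (treeCount k * treeCount l * treeCount (Fintype.card V - (k + l))) := by
  set n := Fintype.card V with hn
  set Φ : ℕ → ℕ → ℝ := fun k l => if k ≤ K ∧ l ≤ K then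
    treeCount k * treeCount l * treeCount (n - (k + l)) else 0 with hΦ
  have hΦ0 : ∀ k l, 0 ≤ Φ k l := by
    intro k l
    simp only [hΦ]
    split_ifs
    · unfold treeCount; positivity
    · exact le_rfl
  have h1 : ∑ G ∈ trees V, (#{p ∈ smallCuts K G ×ˢ smallCuts K G | Disjoint p.1.1 p.2.1} : ℝ) =
      ∑ c : Finset V × V × V, ∑ c' : Finset V × V × V,
        (#{G ∈ trees V | (c ∈ smallCuts K G ∧ c' ∈ smallCuts K G) ∧ Disjoint c.1 c'.1} : ℝ) := by
    rw [← Fintype.sum_prod_type' (f := fun c c' : Finset V × V × V =>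
      (#{G ∈ trees V | (c ∈ smallCuts K G ∧ c' ∈ smallCuts K G) ∧ Disjoint c.1 c'.1} : ℝ))]
    have := sum_card_bipartiteAbove_eq_sum_card_bipartiteBelow (s := trees V)
      (t := (univ : Finset ((Finset V × V × V) × (Finset V × V × V))))
      (fun G p => (p.1 ∈ smallCuts K G ∧ p.2 ∈ smallCuts K G) ∧ Disjoint p.1.1 p.2.1)
    simp only [bipartiteAbove, bipartiteBelow] at this
    have e : ∀ G : SimpleGraph V,
        ({p ∈ smallCuts K G ×ˢ smallCuts K G | Disjoint p.1.1 p.2.1} : Finset _) =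
        ({p | (p.1 ∈ smallCuts K G ∧ p.2 ∈ smallCuts K G) ∧ Disjoint p.1.1 p.2.1} : Finset _) := by
      intro G; ext p; simp
    simp only [e]
    exact_mod_cast this
  have h2 : ∀ c c' : Finset V × V × V,
      (#{G ∈ trees V | (c ∈ smallCuts K G ∧ c' ∈ smallCuts K G) ∧ Disjoint c.1 c'.1} : ℝ) ≤
      if c.2.1 ∈ c.1 then if c'.2.1 ∈ c'.1 then Φ #c.1 #c'.1 else 0 else 0 := by
    intro c c'
    by_cases hcond : c.2.1 ∈ c.1 ∧ c'.2.1 ∈ c'.1 ∧ #c.1 ≤ K ∧ #c'.1 ≤ K ∧ Disjoint c.1 c'.1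
    · obtain ⟨m, m', k, k', hd⟩ := hcond
      rw [if_pos m, if_pos m']
      simp only [hΦ]
      rw [if_pos ⟨k, k'⟩]
      refine le_trans ?_ (card_filter_isCut_isCut_le hK k k' hd c.2.1 c.2.2 c'.2.1 c'.2.2)
      refine Nat.cast_le.2 (card_le_card fun G hG => ?_)
      simp only [mem_filter, mem_smallCuts] at hG ⊢
      exact ⟨hG.1, hG.2.1.1.1, hG.2.1.2.1⟩
    · rw [filter_eq_empty_iff.2, card_empty, Nat.cast_zero]
      · split_ifs
        exacts [hΦ0 _ _, le_rfl, le_rfl]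
      · rintro G - ⟨⟨hc, hc'⟩, hd⟩
        rw [mem_smallCuts] at hc hc'
        exact hcond ⟨by simpa using hc.1.left_mem, by simpa using hc'.1.left_mem, hc.2, hc'.2, hd⟩
  have h3 : ∑ c : Finset V × V × V, ∑ c' : Finset V × V × V,
      (if c.2.1 ∈ c.1 then if c'.2.1 ∈ c'.1 then Φ #c.1 #c'.1 else 0 else 0) =
      ∑ k ∈ range (n + 1), ∑ l ∈ range (n + 1), (n.choose k : ℝ) * (k * n) *
        ((n.choose l : ℝ) * (l * n)) * Φ k l := by
    have e : ∀ c : Finset V × V × V, ∑ c' : Finset V × V × V,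
        (if c.2.1 ∈ c.1 then if c'.2.1 ∈ c'.1 then Φ #c.1 #c'.1 else 0 else 0) =
        if c.2.1 ∈ c.1 then ∑ l ∈ range (n + 1), (n.choose l : ℝ) * (l * n * Φ #c.1 l) else 0 := by
      intro c
      split_ifs
      · exact sum_ite_mem_fst (V := V) (Φ #c.1)
      · exact sum_const_zero
    rw [sum_congr rfl fun c _ => e c, sum_ite_mem_fst (V := V)
      fun k => ∑ l ∈ range (n + 1), (n.choose l : ℝ) * (l * n * Φ k l)]
    refine sum_congr rfl fun k _ => ?_
    rw [mul_sum, mul_sum]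
    refine sum_congr rfl fun l _ => ?_
    rw [← hn]
    ring
  rw [h1]
  refine (sum_le_sum fun c _ => sum_le_sum fun c' _ => h2 c c').trans ?_
  have hKn : range (K + 1) ⊆ range (n + 1) := range_mono (by omega)
  rw [h3]
  refine le_of_eq ?_
  rw [← sum_subset hKn]
  · refine sum_congr rfl fun k hk => ?_
    rw [← sum_subset hKn]
    · refine sum_congr rfl fun l hl => ?_
      simp only [hΦ]
      rw [if_pos ⟨Nat.lt_succ_iff.1 (mem_range.1 hk), Nat.lt_succ_iff.1 (mem_range.1 hl)⟩]
    · intro l _ hl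
      simp only [hΦ]
      rw [if_neg (fun h => hl (mem_range.2 (Nat.lt_succ_iff.2 h.2))), mul_zero]
  · intro k _ hk
    refine sum_eq_zero fun l _ => ?_
    simp only [hΦ]
    rw [if_neg (fun h => hk (mem_range.2 (Nat.lt_succ_iff.2 h.1))), mul_zero]

/-- The square counts ordered pairs of small cuts. The intersecting ones are only linear in the
number of small cuts, hence negligible after division by `n ^ 2`. -/
theorem sum_sq_card_smallCuts_le [Fintype V] {K : ℕ} (hK : 2 * K < Fintype.card V) :
    ∑ G ∈ trees V, (#(smallCuts K G) : ℝ) ^ 2 ≤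
      ∑ k ∈ range (K + 1), ∑ l ∈ range (K + 1),
        ((Fintype.card V).choose k : ℝ) * (k * Fintype.card V) *
        (((Fintype.card V).choose l : ℝ) * (l * Fintype.card V)) *
        (treeCount k * treeCount l * treeCount (Fintype.card V - (k + l))) +
      (K * (K + 1) : ℝ) * ∑ G ∈ trees V, (#(smallCuts K G) : ℝ) := by
  classical
  rw [mul_sum]
  refine le_trans ?_ (add_le_add_left (sum_card_disjoint_le hK) _)
  rw [← sum_add_distrib]
  refine sum_le_sum fun G hG => ?_
  have hGc := (mem_trees.1 hG).connected
  have h1 : #(smallCuts K G) ^ 2 =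
      #{p ∈ smallCuts K G ×ˢ smallCuts K G | Disjoint p.1.1 p.2.1} +
      #{p ∈ smallCuts K G ×ˢ smallCuts K G | ¬ Disjoint p.1.1 p.2.1} := by
    rw [card_filter_add_card_filter_not, card_product, sq]
  have h2 : #{p ∈ smallCuts K G ×ˢ smallCuts K G | ¬ Disjoint p.1.1 p.2.1} ≤
      K * (K + 1) * #(smallCuts K G) := by
    rw [card_filter, sum_product, mul_comm, ← smul_eq_mul, ← sum_const]
    refine sum_le_sum fun c hc => ?_
    rw [← card_filter]
    exact card_smallCuts_not_disjoint_le hK hGc hc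
  have h3 : #(smallCuts K G) ^ 2 ≤
      #{p ∈ smallCuts K G ×ˢ smallCuts K G | Disjoint p.1.1 p.2.1} +
      K * (K + 1) * #(smallCuts K G) := by omega
  exact_mod_cast h3

end Moments
end RandomTree

namespace RandomTree

open Finset Filter Topology

/-! ### Asymptotics of the moments -/

theorem treeCount_pos {n : ℕ} (hn : 1 ≤ n) : 0 < treeCount n := by
  unfold treeCount; positivity

/-- For `n > m` the quotient equals `(1 - m/n) ^ n * (1 - m/n) ^ (-(m + 2))`. -/
theorem tendsto_treeCount_sub (m : ℕ) :
    Tendsto (fun n : ℕ => (n : ℝ) ^ m * treeCount (n - m) / treeCount n) atTop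
      (𝓝 (Real.exp (-m))) := by
  have h0 : Tendsto (fun n : ℕ => 1 + (-(m : ℝ)) / n) atTop (𝓝 1) := by
    simpa using (tendsto_const_div_atTop_nhds_zero_nat (-(m : ℝ))).const_add 1
  have h1 := (Real.tendsto_one_add_div_pow_exp (-(m : ℝ))).mul
    ((h0.pow (m + 2)).inv₀ (by simp))
  simp only [one_pow, inv_one, mul_one] at h1
  refine h1.congr' ?_
  filter_upwards [eventually_gt_atTop m] with n hn
  have hn0 : (n : ℝ) ≠ 0 := Nat.cast_ne_zero.2 (by omega)
  have hnm : (n : ℝ) - m ≠ 0 := by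
    have : (m : ℝ) < n := by exact_mod_cast hn
    linarith
  have e : 1 + (-(m : ℝ)) / n = (n - m) / n := by field_simp; ring
  have e2 : ((n : ℝ) - m) ^ n = (n - m) ^ (n - m) * (n - m) ^ m := by
    rw [← pow_add, Nat.sub_add_cancel hn.le]
  rw [treeCount, treeCount, Nat.cast_sub hn.le, e, div_pow, div_pow, e2]
  field_simp
  ring

theorem tendsto_choose_mul_one_div_pow (k : ℕ) :
    Tendsto (fun n : ℕ => (n.choose k : ℝ) * (1 / (n : ℝ)) ^ k) atTop
      (𝓝 (1 / (k.factorial : ℝ))) := by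
  have := ProbabilityTheory.tendsto_choose_mul_pow_atTop (p := fun n => 1 / (n : ℝ)) (r := 1) k ?_
  · simpa using this
  · refine tendsto_const_nhds.congr' ?_
    filter_upwards [eventually_ge_atTop 1] with n hn
    have : (n : ℝ) ≠ 0 := by positivity
    field_simp

/-- Splits `borel k` into the limits of the factors in the normalized first moment: binomial
coefficient, rooted trees on the part, and ratio of tree counts. -/
theorem borel_eq_mul_exp (k : ℕ) :
    borel k = 1 / (k.factorial : ℝ) * (k * treeCount k) * Real.exp (-k) := by
  rw [natCast_mul_treeCount, borel, div_pow, ← Real.exp_nat_mul, mul_one, Real.exp_neg]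
  rcases Nat.eq_zero_or_pos k with rfl | hk
  · simp
  · field_simp

/-- The mean number of small cuts of a random tree on `Fin n`, divided by `n`. -/
noncomputable def meanSmallCuts (K n : ℕ) : ℝ :=
  (∑ G ∈ trees (Fin n), (#(smallCuts K G) : ℝ)) / (n * treeCount n)

theorem tendsto_meanSmallCuts (K : ℕ) :
    Tendsto (meanSmallCuts K) atTop (𝓝 (∑ k ∈ range (K + 1), borel k)) := by
  have h1 : ∀ k ∈ range (K + 1), Tendsto (fun n : ℕ => (n.choose k : ℝ) * (1 / (n : ℝ)) ^ k *
      (k * treeCount k) * (1 + (-(k : ℝ)) / n) * ((n : ℝ) ^ k * treeCount (n - k) / treeCount n))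
      atTop (𝓝 (borel k)) := by
    intro k _
    have h0 : Tendsto (fun n : ℕ => 1 + (-(k : ℝ)) / n) atTop (𝓝 1) := by
      simpa using (tendsto_const_div_atTop_nhds_zero_nat (-(k : ℝ))).const_add 1
    have := (((tendsto_choose_mul_one_div_pow k).mul_const (k * treeCount k)).mul h0).mul
      (tendsto_treeCount_sub k)
    rwa [mul_one, ← borel_eq_mul_exp] at this
  refine (tendsto_finsetSum _ h1).congr' ?_
  filter_upwards [eventually_ge_atTop (K + 1)] with n hn
  have hn0 : (n : ℝ) ≠ 0 := Nat.cast_ne_zero.2 (by omega)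
  have ht := (treeCount_pos (n := n) (by omega)).ne'
  rw [meanSmallCuts, sum_card_smallCuts (by simpa using by omega), Fintype.card_fin, sum_div]
  refine sum_congr rfl fun k hk => ?_
  have hk' : k ≤ n := by have := mem_range.1 hk; omega
  rw [Nat.cast_sub hk', one_div, inv_pow]
  field_simp
  ring

/-- The upper bound for the contribution of disjoint pairs to the second moment. -/
noncomputable def disjointPairsBound (K n : ℕ) : ℝ :=
  (∑ k ∈ range (K + 1), ∑ l ∈ range (K + 1),
    (n.choose k : ℝ) * (k * n) * ((n.choose l : ℝ) * (l * n)) *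
      (treeCount k * treeCount l * treeCount (n - (k + l)))) / (n ^ 2 * treeCount n)

/-- The limit factorizes because `exp (-(k + l)) = exp (-k) * exp (-l)`; being the square of the
limiting mean, it makes the variance vanish. -/
theorem tendsto_disjointPairsBound (K : ℕ) :
    Tendsto (disjointPairsBound K) atTop (𝓝 ((∑ k ∈ range (K + 1), borel k) ^ 2)) := by
  have h1 : ∀ k ∈ range (K + 1), ∀ l ∈ range (K + 1), Tendsto (fun n : ℕ =>
      ((n.choose k : ℝ) * (1 / (n : ℝ)) ^ k * (k * treeCount k)) *
      ((n.choose l : ℝ) * (1 / (n : ℝ)) ^ l * (l * treeCount l)) *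
      ((n : ℝ) ^ (k + l) * treeCount (n - (k + l)) / treeCount n))
      atTop (𝓝 (borel k * borel l)) := by
    intro k _ l _
    have := (((tendsto_choose_mul_one_div_pow k).mul_const (k * treeCount k)).mul
      ((tendsto_choose_mul_one_div_pow l).mul_const (l * treeCount l))).mul
      (tendsto_treeCount_sub (k + l))
    convert! this using 2
    rw [borel_eq_mul_exp, borel_eq_mul_exp]
    push_cast
    rw [neg_add, Real.exp_add]
    ring
  rw [sq, sum_mul_sum]
  refine (tendsto_finsetSum _ fun k hk => tendsto_finsetSum _ (h1 k hk)).congr' ?_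
  filter_upwards [eventually_ge_atTop 1] with n hn
  have hn0 : (n : ℝ) ≠ 0 := by positivity
  have ht := (treeCount_pos hn).ne'
  rw [disjointPairsBound, sum_div]
  refine sum_congr rfl fun k hk => ?_
  rw [sum_div]
  refine sum_congr rfl fun l hl => ?_
  rw [one_div, inv_pow, inv_pow, pow_add]
  field_simp

/-- A bound for the mean square distance of the proportion of small cuts from its limit. -/
noncomputable def varianceBound (K n : ℕ) : ℝ :=
  disjointPairsBound K n + (K * (K + 1) : ℝ) / n * meanSmallCuts K n -
    2 * (∑ k ∈ range (K + 1), borel k) * meanSmallCuts K n + (∑ k ∈ range (K + 1), borel k) ^ 2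

theorem tendsto_varianceBound (K : ℕ) : Tendsto (varianceBound K) atTop (𝓝 0) := by
  have := (((tendsto_disjointPairsBound K).add
    ((tendsto_const_div_atTop_nhds_zero_nat (K * (K + 1) : ℝ)).mul (tendsto_meanSmallCuts K))).sub
    ((tendsto_meanSmallCuts K).const_mul (2 * ∑ k ∈ range (K + 1), borel k))).add_const
    ((∑ k ∈ range (K + 1), borel k) ^ 2)
  convert! this using 2
  ring

theorem sum_sq_sub_le {K n : ℕ} (hn : 2 * K < n) :
    ∑ G ∈ trees (Fin n), ((#(smallCuts K G) : ℝ) / n - ∑ k ∈ range (K + 1), borel k) ^ 2 ≤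
      treeCount n * varianceBound K n := by
  have hn0 : (n : ℝ) ≠ 0 := Nat.cast_ne_zero.2 (by omega)
  have ht := treeCount_pos (n := n) (by omega)
  set μ := ∑ k ∈ range (K + 1), borel k with hμ
  have h2 := sum_sq_card_smallCuts_le (V := Fin n) (K := K) (by simpa using hn)
  have hc := card_trees (Fin n)
  rw [Fintype.card_fin] at h2 hc
  have hM : ∑ G ∈ trees (Fin n), (#(smallCuts K G) : ℝ) =
      n * treeCount n * meanSmallCuts K n := by
    rw [meanSmallCuts, mul_div_cancel₀ _ (mul_ne_zero hn0 ht.ne')]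
  have hD : ∑ k ∈ range (K + 1), ∑ l ∈ range (K + 1),
      (n.choose k : ℝ) * (k * n) * ((n.choose l : ℝ) * (l * n)) *
      (treeCount k * treeCount l * treeCount (n - (k + l))) =
      n ^ 2 * treeCount n * disjointPairsBound K n := by
    rw [disjointPairsBound, mul_div_cancel₀ _ (mul_ne_zero (pow_ne_zero 2 hn0) ht.ne')]
  rw [hD, hM] at h2
  have hexp : ∑ G ∈ trees (Fin n), ((#(smallCuts K G) : ℝ) / n - μ) ^ 2 =
      (∑ G ∈ trees (Fin n), (#(smallCuts K G) : ℝ) ^ 2) / n ^ 2 -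
      2 * μ / n * (∑ G ∈ trees (Fin n), (#(smallCuts K G) : ℝ)) + treeCount n * μ ^ 2 := by
    rw [sum_div, mul_sum, ← sum_sub_distrib, ← hc, ← nsmul_eq_mul, ← sum_const, ← sum_add_distrib]
    refine sum_congr rfl fun G _ => ?_
    field_simp
    ring
  rw [hexp, hM]
  have h3 : (∑ G ∈ trees (Fin n), (#(smallCuts K G) : ℝ) ^ 2) / n ^ 2 ≤
      treeCount n * disjointPairsBound K n +
        treeCount n * ((K * (K + 1) : ℝ) / n * meanSmallCuts K n) := by
    rw [div_le_iff₀ (by positivity)]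
    refine h2.trans (le_of_eq ?_)
    field_simp
  have h4 : 2 * μ / n * (n * treeCount n * meanSmallCuts K n) =
      treeCount n * (2 * μ * meanSmallCuts K n) := by field_simp
  rw [varianceBound, ← hμ, h4]
  linarith

/-- Chebyshev's inequality for the proportion of small cuts. -/
theorem card_filter_lt_abs_le {K n : ℕ} (hn : 2 * K < n) {δ : ℝ} (hδ : 0 < δ)
    [DecidablePred fun G : SimpleGraph (Fin n) =>
      δ < |(#(smallCuts K G) : ℝ) / n - ∑ k ∈ range (K + 1), borel k|] :
    (#{G ∈ trees (Fin n) | δ < |(#(smallCuts K G) : ℝ) / n - ∑ k ∈ range (K + 1), borel k|} : ℝ) ≤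
      treeCount n * (varianceBound K n / δ ^ 2) := by
  rw [← mul_div_assoc, le_div_iff₀ (by positivity)]
  refine le_trans ?_ (sum_sq_sub_le hn)
  rw [← nsmul_eq_mul, ← sum_const]
  refine le_trans (sum_le_sum fun G hG => ?_) (sum_le_sum_of_subset_of_nonneg (filter_subset _ _)
    fun G _ _ => sq_nonneg _)
  have := (mem_filter.1 hG).2
  rw [← sq_abs ((#(smallCuts K G) : ℝ) / n - _)]
  exact pow_le_pow_left₀ hδ.le this.le 2

/-! ### Internal vertices -/

theorem branch_eq_of_isCut {n : ℕ} {G : SimpleGraph (Fin n)} (hG : G.IsTree) {S : Set (Fin n)}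
    {v w : Fin n} (hc : IsCut G S v w) : branch G v w = S :=
  IsCut.side_unique (isCut_of_adj hG.isAcyclic hc.adj) hc hG.connected

/-- Any branch of a tree is a tree and can be relabelled by the order isomorphism with `Fin k`, so
only its size matters. -/
theorem notMem_internalVertices_iff {K n : ℕ} {G : SimpleGraph (Fin n)} (hG : G.IsTree)
    {v : Fin n} : v ∉ internalVertices K G ↔ ∃ c ∈ smallCuts K G, c.2.1 = v := by
  classical
  rw [internalVertices, Set.mem_ofPred_eq, not_not]
  constructor
  · rintro ⟨k, hk, T, r, -, w, hadj, e, -⟩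
    refine ⟨((branch G v w).toFinset, v, w), mem_smallCuts.2 ⟨?_, ?_⟩, rfl⟩
    · rw [Set.coe_toFinset]
      exact isCut_of_adj hG.isAcyclic hadj
    · rw [Set.toFinset_card, ← Fintype.card_congr e.toEquiv, Fintype.card_fin]
      exact hk
  · rintro ⟨⟨S, v', w⟩, hc, rfl⟩
    obtain ⟨hc, hK⟩ := mem_smallCuts.1 hc
    have hb := branch_eq_of_isCut hG hc
    have hfin : S = (branch G v' w).toFinset := by
      rw [← coe_inj, Set.coe_toFinset]; exact hb.symm
    have hcard : #S = Fintype.card (branch G v' w) := by rw [hfin, Set.toFinset_card]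
    let e : Fin #S ≃o branch G v' w := Fintype.orderIsoFinOfCardEq _ hcard.symm
    have hv : v' ∈ branch G v' w := hb ▸ hc.left_mem
    refine ⟨#S, hK, (G.deleteEdges {s(v', w)}).comap fun i => (e i : Fin n), e.symm ⟨v', hv⟩, ?_,
      w, hc.adj, e, by simp, fun i j => Iff.rfl⟩
    -- The deleted edge has its endpoint `w` outside the branch, so deletion changes nothing inside.
    have hind : (G.deleteEdges {s(v', w)}).induce (branch G v' w) = G.induce (branch G v' w) := by
      ext x y
      simp only [SimpleGraph.comap_adj, SimpleGraph.deleteEdges_adj, Set.mem_singleton_iff,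
        Function.Embedding.subtype_apply, and_iff_left_iff_imp]
      intro _ heq
      have hw : w ∉ branch G v' w := hb ▸ hc.right_notMem
      have hmem : w ∈ s((x : Fin n), (y : Fin n)) := heq ▸ Sym2.mem_mk_right _ _
      rcases Sym2.mem_iff.1 hmem with h | h
      · exact hw (Set.mem_of_eq_of_mem h x.2)
      · exact hw (Set.mem_of_eq_of_mem h y.2)
    have htree : ((G.deleteEdges {s(v', w)}).induce (branch G v' w)).IsTree := by
      rw [hind, hb]
      exact hc.isTree_induce hG
    exact (SimpleGraph.Iso.comap e.toEquiv
      ((G.deleteEdges {s(v', w)}).induce (branch G v' w))).isTree_iff.2 htree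

/-- Small cuts are determined by their roots: two small parts with the same root meet, hence are
nested, hence use the same edge. -/
theorem ncard_internalVertices {K n : ℕ} (hn : 2 * K < n) {G : SimpleGraph (Fin n)}
    (hG : G.IsTree) : (internalVertices K G).ncard + #(smallCuts K G) = n := by
  classical
  have h1 : (internalVertices K G)ᶜ = ((smallCuts K G).image fun c => c.2.1 : Finset (Fin n)) := by
    ext v
    rw [Set.mem_compl_iff, notMem_internalVertices_iff hG]
    simp
  have h2 : #((smallCuts K G).image fun c => c.2.1) = #(smallCuts K G) := by
    refine card_image_of_injOn fun c hc c' hc' heq => ?_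
    obtain ⟨S, r, w⟩ := c
    obtain ⟨S', r', w'⟩ := c'
    simp only at heq
    subst heq
    have hnest := small_nested_or_disjoint (by simpa using hn) hG.connected (mem_coe.1 hc)
      (mem_coe.1 hc')
    have hcS := (mem_smallCuts.1 (mem_coe.1 hc)).1
    have hcS' := (mem_smallCuts.1 (mem_coe.1 hc')).1
    simp only at hnest hcS hcS'
    have hww : w = w' := by
      rcases hnest with h | h | h
      · exact hcS.right_unique_of_subset hcS' (by exact_mod_cast h)
      · exact (hcS'.right_unique_of_subset hcS (by exact_mod_cast h)).symm
      · exact absurd hcS'.left_mem (by simpa using disjoint_left.1 h (by simpa using hcS.left_mem))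
    subst hww
    rw [coe_injective (hcS.side_unique hcS' hG.connected)]
  have h3 := Set.ncard_add_ncard_compl (internalVertices K G)
  rw [h1, Set.ncard_coe_finset, h2, Nat.card_eq_fintype_card, Fintype.card_fin] at h3
  exact h3

theorem h_eq_one_sub_sum_range (K : ℕ) : h K = 1 - ∑ k ∈ range (K + 1), borel k := by
  rw [h_eq, sum_range_succ', borel_zero, add_zero, range_eq_Ico, sum_Ico_add' borel 0 K 1]
  rfl

/-! ### The law of large numbers -/

instance {n : ℕ} : MeasurableSingletonClass (SimpleGraph (Fin n)) where
  measurableSet_singleton G := by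
    have : ({G} : Set (SimpleGraph (Fin n))) = SimpleGraph.edgeSet ⁻¹' {G.edgeSet} := by
      ext H; simp
    rw [this]
    exact SimpleGraph.measurable_edgeSet (measurableSet_singleton _)

theorem law_apply {n : ℕ} (p : SimpleGraph (Fin n) → Prop) [DecidablePred p] :
    law n {G | p G} = (#{G ∈ trees (Fin n) | p G} : ENNReal) / #(trees (Fin n)) := by
  classical
  have h1 : {G : SimpleGraph (Fin n) | G.IsTree} = (trees (Fin n) : Set _) := by ext; simp
  have h2 : trees (Fin n) ∩ ({G | p G} : Finset _) = {G ∈ trees (Fin n) | p G} := by ext; simp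
  have h3 : {G | p G} = (({G | p G} : Finset (SimpleGraph (Fin n))) : Set _) := by ext; simp
  rw [law, h1, h3, ProbabilityTheory.uniformOn_apply_finset, h2]

/-- As `|R| = n - X` and `h K = 1 - μ`, where `X` counts the small cuts and `μ` is the limit of `X /
n`, the relative error of `|R|` is `-(X / n - μ) / h K`. Positivity of `h K` is essential. -/
theorem abs_sub_one_le_iff {K n : ℕ} (hn : 2 * K < n) {G : SimpleGraph (Fin n)} (hG : G.IsTree)
    (ε : ℝ) : |((internalVertices K G).ncard : ℝ) / n / h K - 1| ≤ ε ↔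
      ¬ ε * h K < |(#(smallCuts K G) : ℝ) / n - ∑ k ∈ range (K + 1), borel k| := by
  have hn0 : (n : ℝ) ≠ 0 := Nat.cast_ne_zero.2 (by omega)
  have hh := h_pos K
  have hR : ((internalVertices K G).ncard : ℝ) = n - #(smallCuts K G) := by
    rw [eq_sub_iff_add_eq]; exact_mod_cast ncard_internalVertices hn hG
  have e : ((internalVertices K G).ncard : ℝ) / n / h K - 1 =
      -((#(smallCuts K G) : ℝ) / n - ∑ k ∈ range (K + 1), borel k) / h K := by
    have := h_eq_one_sub_sum_range K
    rw [hR, eq_div_iff hh.ne', sub_mul, div_mul_cancel₀ _ hh.ne', sub_div, div_self hn0, this]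
    ring
  rw [e, abs_div, abs_neg, abs_of_pos hh, div_le_iff₀ hh, not_lt]

theorem tendsto_law (K : ℕ) {ε : ℝ} (hε : 0 < ε) :
    Tendsto (fun n : ℕ => law n {G | |((internalVertices K G).ncard : ℝ) / (n : ℝ) / h K - 1| ≤ ε})
      atTop (𝓝 1) := by
  classical
  set δ := ε * h K with hδ
  have hδ0 : 0 < δ := mul_pos hε (h_pos K)
  have hlow : Tendsto (fun n => ENNReal.ofReal (1 - varianceBound K n / δ ^ 2)) atTop (𝓝 1) := by
    have := ((tendsto_varianceBound K).div_const (δ ^ 2)).const_sub 1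
    rw [zero_div, sub_zero] at this
    simpa using ENNReal.tendsto_ofReal this
  refine tendsto_of_tendsto_of_tendsto_of_le_of_le' hlow tendsto_const_nhds ?_ ?_
  · filter_upwards [eventually_gt_atTop (2 * K)] with n hn
    have ht : 0 < treeCount n := treeCount_pos (by omega)
    have hc := card_trees (Fin n)
    rw [Fintype.card_fin] at hc
    rw [law_apply, ← ENNReal.ofReal_natCast, ← ENNReal.ofReal_natCast,
      ← ENNReal.ofReal_div_of_pos (by rw [hc]; exact ht)]
    refine ENNReal.ofReal_le_ofReal ?_
    rw [hc, le_div_iff₀ ht]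
    have hsplit := card_filter_add_card_filter_not (s := trees (Fin n)) fun G =>
      δ < |(#(smallCuts K G) : ℝ) / n - ∑ k ∈ range (K + 1), borel k|
    have hgood : #{G ∈ trees (Fin n) | |((internalVertices K G).ncard : ℝ) / n / h K - 1| ≤ ε} =
        #{G ∈ trees (Fin n) |
          ¬ δ < |(#(smallCuts K G) : ℝ) / n - ∑ k ∈ range (K + 1), borel k|} :=
      congrArg card (filter_congr fun G hG => abs_sub_one_le_iff hn (mem_trees.1 hG) ε)
    have hsplit' : (#{G ∈ trees (Fin n) |
          δ < |(#(smallCuts K G) : ℝ) / n - ∑ k ∈ range (K + 1), borel k|} : ℝ) +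
        #{G ∈ trees (Fin n) | |((internalVertices K G).ncard : ℝ) / n / h K - 1| ≤ ε} =
        treeCount n := by
      rw [hgood, ← hc]; exact_mod_cast hsplit
    have hcheb := card_filter_lt_abs_le hn hδ0
    linarith
  · refine Eventually.of_forall fun n => ?_
    rw [law_apply]
    exact ENNReal.div_le_of_le_mul (by rw [one_mul]; exact_mod_cast card_filter_le _ _)

end RandomTree

theorem mainTheorem6 :
    (∀ K : ℕ, ∀ ε : ℝ, 0 < ε →
      Filter.Tendsto
        (fun n : ℕ => RandomTree.law n
          {G | |((RandomTree.internalVertices K G).ncard : ℝ) / (n : ℝ) / RandomTree.h K - 1| ≤ ε})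
        Filter.atTop (nhds 1)) ∧
    Asymptotics.IsTheta Filter.atTop RandomTree.h (fun K : ℕ => 1 / Real.sqrt (K : ℝ)) :=
  ⟨fun K _ hε => RandomTree.tendsto_law K hε, RandomTree.h_isTheta⟩
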